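/- Let $d\ge 14$, let $\mathbb{T}_d$ be the infinite $(d+1)$-regular tree and let $\rho$ be a vertex of it. Given particle counts $(\eta(v))_{v\in\mathbb{T}_d}$, consider the frog model started at $\rho$: the $\eta(\rho)$ particles at $\rho$ are active at time $0$, and every other site $v$ holds $\eta(v)$ sleeping particles. In discrete time, active particles perform independent simple random walks on $\mathbb{T}_d$, independent of the counts, and when an active particle visits a site all sleeping particles there are activated. A realization is recurrent if $\rho$ is visited infinitely often by active particles, and transient otherwise. The counts $\eta(v)$, $v\in\mathbb{T}_d$, are independent, and $\eta(\rho)$ may have an arbitrary distribution $\nu_0$ on $\{0,1,2,\dots\}$ (for example, exactly one particle, or the same distribution as at the other sites). For $\mu>0$ and integers $N\ge\mu$ put $$\pi_N=\frac{\mu}{N}\,\delta_N+\Bigl(1-\frac{\mu}{N}\Bigr)\delta_0 .$$ 1. For every $\mu>0$ there is $N_0\ge \mu$ such that for all integers $N\ge N_0$ and every $\nu_0$: if each $\eta(v)$, $v\neq\rho$, is distributed as $1+X$ with $X\sim\pi_N$ (one guaranteed particle plus a $\pi_N$-distributed number), then the frog model is almost surely transient. 2. There is a probability distribution $\pi$ on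 $\{0,1,2,\dots\}$ with infinite mean such that for every $\nu_0$: if each $\eta(v)$, $v\neq\rho$, is distributed as $1+X$ with $X\sim\pi$, then the frog model is almost surely transient. In particular, transience can occur even when every site holds at least one particle. -/

import Mathlib

open MeasureTheory ProbabilityTheory
open scoped ENNReal

namespace FrogModel

/-! ### Deterministic dynamics

`η v` is the number of frogs initially at the site `v`; the frogs at `v` are labelled `(v, i)` with
`i < η v`.  `S v i s` is the position of the frog `(v, i)` after it has made `s` steps since
its activation. -/

section Dynamics

variable {V : Type*}

/-- The set of active frogs at time `n`.  A triple `(u, i, s)` belongs to it if the frog `(u, i)` is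
active at time `n` and has made `s` steps so far; it then sits at `S u i s`.
At time `0` exactly the frogs at the starting site `ρ` are active.  From time `n` to time `n + 1` each
active frog makes one step, and whenever an active frog lands on a site `v` whose own frogs are still
asleep, all frogs of `v` are activated (with no step made yet). -/
def active (ρ : V) (η : V → ℕ) (S : V → ℕ → ℕ → V) : ℕ → Set (V × ℕ × ℕ)
  | 0 => {a | a.1 = ρ ∧ a.2.1 < η ρ ∧ a.2.2 = 0}
  | n + 1 =>
      {a | ∃ u i s, (u, i, s) ∈ active ρ η S n ∧ a = (u, i, s + 1)} ∪
      {a | ∃ v i, a = (v, i, 0) ∧ i < η v ∧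
        (∀ j s, (v, j, s) ∉ active ρ η S n) ∧
        ∃ u j s, (u, j, s) ∈ active ρ η S n ∧ S u j (s + 1) = v}

/-- All visits to the starting site: the triples `(n, u, i)` such that at time `n` the frog `(u, i)`
is active and located at `ρ`. -/
def rootVisits (ρ : V) (η : V → ℕ) (S : V → ℕ → ℕ → V) : Set (ℕ × V × ℕ) :=
  {a | ∃ s, (a.2.1, a.2.2, s) ∈ active ρ η S a.1 ∧ S a.2.1 a.2.2 s = ρ}

/-- A realization is recurrent if the starting site is visited infinitely often. -/
def IsRecurrent (ρ : V) (η : V → ℕ) (S : V → ℕ → ℕ → V) : Prop :=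
  (rootVisits ρ η S).Infinite

/-- A realization is transient if it is not recurrent. -/
def IsTransient (ρ : V) (η : V → ℕ) (S : V → ℕ → ℕ → V) : Prop :=
  ¬ IsRecurrent ρ η S

end Dynamics

/-! ### Randomness -/

noncomputable section Randomness

variable {V : Type*} (G : SimpleGraph V) [G.LocallyFinite]

open Classical in
/-- One step of simple random walk from `v`: a uniform neighbour (stay put if there is none). -/
def stepPMF (v : V) : PMF V :=
  if h : (G.neighborFinset v).Nonempty then PMF.uniformOfFinset (G.neighborFinset v) h
  else PMF.pure v

variable [MeasurableSpace V] [DiscreteMeasurableSpace V]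

/-- The transition kernel of simple random walk, at the step from time `n` to time `n + 1`, as a
function of the trajectory up to time `n`, of which it only uses the last position. -/
def stepKernel (n : ℕ) : Kernel (Finset.Iic n → V) V where
  toFun x := (stepPMF G (x ⟨n, Finset.mem_Iic.2 le_rfl⟩)).toMeasure
  measurable' :=
    (Measurable.of_discrete (f := fun v : V => (stepPMF G v).toMeasure)).comp
      (measurable_pi_apply _)

instance (n : ℕ) : IsMarkovKernel (stepKernel G n) :=
  ⟨fun x => PMF.toMeasure.isProbabilityMeasure (stepPMF G (x ⟨n, Finset.mem_Iic.2 le_rfl⟩))⟩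

/-- The law of the trajectory of simple random walk on `G` started at `v`. -/
def walkLaw (v : V) : Measure (ℕ → V) :=
  Kernel.trajMeasure (X := fun _ => V) (Measure.dirac v) (stepKernel G)

instance (v : V) : IsProbabilityMeasure (walkLaw G v) := by
  unfold walkLaw; infer_instance

open Classical in
/-- Independent initial counts: law `ν₀` at the starting site `ρ`, law `ν` at every other site. -/
def countLaw (ρ : V) (ν₀ ν : Measure ℕ) : Measure (V → ℕ) :=
  Measure.infinitePi fun v => if v = ρ then ν₀ else ν

/-- Independent simple random walks, the walk with label `(v, i)` being started at `v`. -/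
def walksLaw : Measure (V × ℕ → ℕ → V) :=
  Measure.infinitePi fun p => walkLaw G p.1

/-- The joint law of the initial counts and of the walks, which are independent. -/
def frogLaw (ρ : V) (ν₀ ν : Measure ℕ) : Measure ((V → ℕ) × (V × ℕ → ℕ → V)) :=
  (countLaw ρ ν₀ ν).prod (walksLaw G)

instance (ρ : V) (ν₀ ν : Measure ℕ) [IsProbabilityMeasure ν₀] [IsProbabilityMeasure ν] :
    IsProbabilityMeasure (frogLaw G ρ ν₀ ν) := by
  classical
  have h : ∀ v : V, IsProbabilityMeasure (if v = ρ then ν₀ else ν) := fun v => by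
    split_ifs <;> infer_instance
  unfold frogLaw countLaw walksLaw
  infer_instance

/-- The frog model on `G` started at `ρ`, with all frogs at `ρ` (whose number has law `ν₀`) active and
with i.i.d. numbers of sleeping frogs of law `ν` at all other sites, is almost surely transient. -/
def AlmostSurelyTransient (ρ : V) (ν₀ ν : Measure ℕ) : Prop :=
  ∀ᵐ ω ∂(frogLaw G ρ ν₀ ν), IsTransient ρ ω.1 (fun v i => ω.2 (v, i))

end Randomness

/-- The distribution `(μ / N) δ_N + (1 - μ / N) δ_0` on `ℕ`, for `0 < N` and `0 ≤ μ ≤ N`. -/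
noncomputable def islandLaw (μ : ℝ) (N : ℕ) : Measure ℕ :=
  ENNReal.ofReal (μ / N) • Measure.dirac N + ENNReal.ofReal (1 - μ / N) • Measure.dirac 0

/-- The law of `X + 1` when `X` has law `ν`. -/
noncomputable def plusOne (ν : Measure ℕ) : Measure ℕ :=
  ν.map (fun n => n + 1)

end FrogModel

/-! The proof is a first-moment bound over activation chains. Each activated site is traced back to
ρ through sites whose frogs woke the next one. The sites of such a chain are distinct, and whether
some frog of u visits w depends only on the count and walks at u, so the events along a chain are
independent (`measure_inter_returnEvent`).

Let W(v) = d^(-dist(ρ,v)/2). One step of the walk contracts W by m = 2√d/(d+1)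
(`tsum_stepPMF_pow_dist_le`). If for every u ≠ ρ the sum over w of P(u hits w) W(w) is at most θ
W(u) with θ < 1, then, once the count at ρ is truncated, the expected number of sites at the end of
a chain of length n that send a frog back to ρ decays like θ^n. By Borel–Cantelli only finitely many
sites send frogs back (`ae_finite_return`), and each frog visits ρ finitely often.

One frog per site contributes m + m² + ... = m/(1-m), which is below 1 once m < 1/2; this is where d
≥ 14 enters. For X additional frogs, E min(1, Xp) ≤ E[X^a] p^a with 0 < a < 1. A nonzero n-step
probability p is at least (d+1)^(-n), so p^a ≤ λ^n p with λ = (d+1)^(1-a). With a close enough to 1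
that λm < 1, smallness of E[X^a] suffices, whatever the mean of X. Sparse islands and a diluted
heavy-tailed law both have small fractional moments. -/

namespace FrogModel

/-! ### Transition probabilities of simple random walk -/

section Walk

variable {V : Type*} (G : SimpleGraph V) [G.LocallyFinite]

/-- A connected locally finite graph has countably many vertices. -/
lemma countable_of_connected_of_locallyFinite (hG : G.Connected) : Countable V := by
  classical
  obtain ⟨ρ⟩ := hG.nonempty
  have hfin : ∀ n : ℕ, {v | G.dist ρ v ≤ n}.Finite := by
    intro n
    induction n with
    | zero =>
      refine (Set.finite_singleton ρ).subset fun v hv => ?_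
      have h0 : G.dist ρ v = 0 := by simpa using hv
      exact ((hG.dist_eq_zero_iff).1 h0).symm
    | succ n ih =>
      refine (ih.union (ih.biUnion fun v _ => (G.neighborFinset v).finite_toSet)).subset
        fun v hv => ?_
      rcases Nat.lt_or_ge (G.dist ρ v) (n + 1) with h | h
      · exact Or.inl (Nat.lt_succ_iff.1 h)
      · right
        have hd : G.dist ρ v = n + 1 := le_antisymm hv h
        obtain ⟨p, hp⟩ := hG.exists_walk_length_eq_dist v ρ
        rw [SimpleGraph.dist_comm, hd] at hp
        cases p with
        | nil => simp at hp
        | cons hadj q =>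
          rename_i w
          simp only [SimpleGraph.Walk.length_cons, Nat.add_right_cancel_iff] at hp
          simp only [Set.mem_iUnion]
          refine ⟨w, ?_, ?_⟩
          · change G.dist ρ w ≤ n
            rw [SimpleGraph.dist_comm, ← hp]
            exact SimpleGraph.dist_le q
          · simpa using hadj.symm
  have : (Set.univ : Set V) = ⋃ n : ℕ, {v | G.dist ρ v ≤ n} := by
    ext v; simpa using ⟨G.dist ρ v, le_rfl⟩
  rw [← Set.countable_univ_iff, this]
  exact Set.countable_iUnion fun n => (hfin n).countable

lemma stepPMF_apply_of_degree {d : ℕ} (hreg : G.IsRegularOfDegree (d + 1)) (v w : V)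
    [Decidable (w ∈ G.neighborFinset v)] :
    stepPMF G v w = if w ∈ G.neighborFinset v then ((d : ℝ≥0∞) + 1)⁻¹ else 0 := by
  have hcard : (G.neighborFinset v).card = d + 1 := hreg v
  have hne : (G.neighborFinset v).Nonempty := Finset.card_pos.1 (by omega)
  rw [stepPMF, dif_pos hne, PMF.uniformOfFinset_apply]
  simp [hcard]

variable [MeasurableSpace V] [DiscreteMeasurableSpace V]

/-- The `n`-step transition probabilities of simple random walk. -/
noncomputable def transProb (n : ℕ) (u w : V) : ℝ≥0∞ := walkLaw G u {S | S n = w}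

omit [G.LocallyFinite] in
lemma measurableSet_eval_eq (n : ℕ) (w : V) : MeasurableSet {S : ℕ → V | S n = w} :=
  (measurable_pi_apply (X := fun _ : ℕ => V) n) (measurableSet_singleton w)

lemma lintegral_walkLaw_succ (u : V) (n : ℕ) (f : V → ℝ≥0∞) :
    ∫⁻ S, f (S (n + 1)) ∂(walkLaw G u) =
      ∫⁻ S, ∫⁻ w, f w ∂(stepPMF G (S n)).toMeasure ∂(walkLaw G u) := by
  have h := Kernel.map_frestrictLe_trajMeasure_compProd_eq_map_trajMeasure (X := fun _ => V)
    (μ₀ := Measure.dirac u) (κ := stepKernel G) (a := n)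
  have hf : Measurable f := Measurable.of_discrete
  have h2 := congrArg (fun μ => ∫⁻ x, f x.2 ∂μ) h
  rw [Measure.lintegral_compProd (by fun_prop), lintegral_map (by fun_prop) (by fun_prop),
    lintegral_map (by fun_prop) (by fun_prop)] at h2
  exact h2.symm

lemma lintegral_walkLaw_eval [Countable V] (u : V) (n : ℕ) (f : V → ℝ≥0∞) :
    ∫⁻ S, f (S n) ∂(walkLaw G u) = ∑' w, transProb G n u w * f w := by
  have hf : Measurable f := Measurable.of_discrete
  rw [← lintegral_map (μ := walkLaw G u) (g := fun S : ℕ → V => S n) hf (by fun_prop),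
    lintegral_countable']
  refine tsum_congr fun w => ?_
  rw [Measure.map_apply (by fun_prop) (measurableSet_singleton w), mul_comm]
  rfl

lemma transProb_succ [Countable V] (u w : V) (n : ℕ) :
    transProb G (n + 1) u w = ∑' v, transProb G n u v * stepPMF G v w := by
  classical
  have h := lintegral_walkLaw_succ G u n (Set.indicator {w} 1)
  have e1 : (fun S : ℕ → V => Set.indicator {w} (1 : V → ℝ≥0∞) (S (n + 1))) =
      Set.indicator {S | S (n + 1) = w} 1 := by
    ext S; simp [Set.indicator]
  rw [e1, lintegral_indicator_one (measurableSet_eval_eq _ _)] at h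
  rw [transProb, h]
  simp only [lintegral_indicator_one (measurableSet_singleton w),
    PMF.toMeasure_apply_singleton _ _ (measurableSet_singleton w)]
  rw [lintegral_walkLaw_eval G u n fun v => stepPMF G v w]

lemma walkLaw_eval_zero (u : V) : ∀ᵐ S ∂(walkLaw G u), S 0 = u := by
  set x₀ : Finset.Iic 0 → V := fun _ => u
  have h0 : (walkLaw G u).map (Preorder.frestrictLe (π := fun _ => V) 0) = Measure.dirac x₀ := by
    rw [walkLaw, Kernel.trajMeasure, Measure.map_comp _ _ (by fun_prop),
      Kernel.traj_map_frestrictLe, Kernel.partialTraj_self, Measure.id_comp]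
    exact (Measure.map_dirac' (MeasurableEquiv.measurable _) u).trans rfl
  have h1 : ∀ᵐ x ∂((walkLaw G u).map (Preorder.frestrictLe (π := fun _ => V) 0)),
      x ⟨0, Finset.mem_Iic.2 le_rfl⟩ = u := by
    rw [h0, ae_dirac_iff]
    exact (measurable_pi_apply (X := fun _ : Finset.Iic 0 => V) _) (measurableSet_singleton u)
  exact ae_of_ae_map (by fun_prop) h1

lemma transProb_zero (u w : V) [Decidable (w = u)] :
    transProb G 0 u w = if w = u then 1 else 0 := by
  have h := walkLaw_eval_zero G u
  split_ifs with hw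
  · subst hw
    exact prob_compl_eq_zero_iff (measurableSet_eval_eq 0 w) |>.1 h
  · refine measure_mono_null (fun S hS => ?_) h
    simp only [Set.mem_ofPred_eq] at hS
    simp [hS, hw]

/-- If w can be reached at all, a single path of n steps already has probability (d+1)^(-n). This
lower bound is what lets p^a be exchanged for a multiple of p. -/
lemma transProb_eq_zero_or_le [Countable V] {d : ℕ} (hreg : G.IsRegularOfDegree (d + 1))
    (n : ℕ) (u w : V) :
    transProb G n u w = 0 ∨ (((d : ℝ≥0∞) + 1)⁻¹) ^ n ≤ transProb G n u w := by
  classical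
  induction n generalizing w with
  | zero => rw [transProb_zero]; split_ifs <;> simp
  | succ n ih =>
    rw [or_iff_not_imp_left]
    intro h
    rw [transProb_succ] at h ⊢
    rw [ENNReal.tsum_eq_zero] at h
    push Not at h
    obtain ⟨v, hv⟩ := h
    refine le_trans ?_ (ENNReal.le_tsum v)
    have h1 := (ih v).resolve_left (left_ne_zero_of_mul hv)
    have h2 := right_ne_zero_of_mul hv
    rw [stepPMF_apply_of_degree G hreg] at h2 ⊢
    have h3 : w ∈ G.neighborFinset v := by by_contra h; simp [h] at h2
    rw [if_pos h3, pow_succ]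
    gcongr

/-- A function that one step of the walk contracts by a factor `m` is contracted by `m ^ n` in
`n` steps. -/
lemma tsum_transProb_mul_le [Countable V] (W : V → ℝ≥0∞) (m : ℝ≥0∞)
    (hW : ∀ v, ∑' w, stepPMF G v w * W w ≤ m * W v) (n : ℕ) (u : V) :
    ∑' w, transProb G n u w * W w ≤ m ^ n * W u := by
  classical
  induction n with
  | zero =>
    simp only [transProb_zero, ite_mul, one_mul, zero_mul, pow_zero, tsum_ite_eq, le_refl]
  | succ n ih =>
    calc ∑' w, transProb G (n + 1) u w * W w
        = ∑' v, transProb G n u v * ∑' w, stepPMF G v w * W w := by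
          simp only [transProb_succ, ← ENNReal.tsum_mul_right]
          rw [ENNReal.tsum_comm]
          simp only [← ENNReal.tsum_mul_left, mul_assoc]
      _ ≤ ∑' v, transProb G n u v * (m * W v) := by gcongr with v; exact hW v
      _ = m * ∑' v, transProb G n u v * W v := by
          rw [← ENNReal.tsum_mul_left]; congr with v; ring
      _ ≤ m * (m ^ n * W u) := by gcongr
      _ = m ^ (n + 1) * W u := by ring

end Walk

/-! ### The contracting weight on the regular tree -/

section Tree

variable {V : Type*} (G : SimpleGraph V)

/-- In a tree, a vertex has at most one neighbour closer to the root. -/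
lemma eq_of_adj_of_dist_succ (hG : G.IsTree) (ρ : V) {v w w' : V} (hw : G.Adj v w)
    (hw' : G.Adj v w') (h : G.dist ρ v = G.dist ρ w + 1) (h' : G.dist ρ v = G.dist ρ w' + 1) :
    w = w' := by
  obtain ⟨p, hp, hpl⟩ := hG.connected.exists_path_of_dist ρ v
  have key : ∀ x, G.Adj v x → G.dist ρ v = G.dist ρ x + 1 → x ∈ p.support := by
    intro x hx hd
    -- If x were off `p`, acyclicity would put v on the shortest path `q` to x, making v no farther
    -- from ρ than x.
    obtain ⟨q, hq, hql⟩ := hG.connected.exists_path_of_dist ρ x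
    refine hG.isAcyclic.mem_support_of_ne_mem_support_of_adj_of_isPath hp hq hx fun hv => ?_
    classical
    have h1 := SimpleGraph.dist_le (q.takeUntil v hv)
    have h2 := q.length_takeUntil_le_length hv
    omega
  rw [hG.isAcyclic.eq_penultimate_of_adj_end hp hw (key w hw h),
    hG.isAcyclic.eq_penultimate_of_adj_end hp hw' (key w' hw' h')]

variable [G.LocallyFinite]

/-- Away from ρ, one neighbour multiplies the weight by √d and the other d divide it by √d: in total
√d + d/√d = 2√d. At ρ all d+1 neighbours divide by √d, and (d+1)/√d ≤ 2√d. The exponent 1/2 balances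
the two directions. -/
lemma tsum_stepPMF_pow_dist_le (hG : G.IsTree) {d : ℕ} (hd : 1 ≤ d)
    (hreg : G.IsRegularOfDegree (d + 1)) (ρ v : V) :
    ∑' w, stepPMF G v w * ENNReal.ofReal ((√d)⁻¹ ^ G.dist ρ w) ≤
      ENNReal.ofReal (2 * √d / (d + 1)) * ENNReal.ofReal ((√d)⁻¹ ^ G.dist ρ v) := by
  classical
  have hd' : (1 : ℝ) ≤ d := by exact_mod_cast hd
  set s := √(d : ℝ) with hs
  have hs1 : 1 ≤ s := by rw [hs]; exact Real.one_le_sqrt.2 hd'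
  have hss : s * s = d := Real.mul_self_sqrt (by linarith)
  have hs0 : 0 < s := by linarith
  have hcard : (G.neighborFinset v).card = d + 1 := hreg v
  have hsum : ∑ w ∈ G.neighborFinset v, s⁻¹ ^ G.dist ρ w ≤ 2 * s * s⁻¹ ^ G.dist ρ v := by
    by_cases hex : ∃ w ∈ G.neighborFinset v, G.dist ρ v = G.dist ρ w + 1
    · obtain ⟨w, hw, hwd⟩ := hex
      rw [← Finset.add_sum_erase _ _ hw]
      have hrest : ∀ x ∈ (G.neighborFinset v).erase w,
          s⁻¹ ^ G.dist ρ x = s⁻¹ ^ (G.dist ρ v + 1) := by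
        intro x hx
        rw [Finset.mem_erase] at hx
        have hxa : G.Adj v x := by simpa using hx.2
        rcases hG.dist_eq_dist_add_one_of_adj ρ hxa with h | h
        · exact absurd (eq_of_adj_of_dist_succ G hG ρ hxa (by simpa using hw) h hwd) hx.1
        · rw [h]
      rw [Finset.sum_congr rfl hrest, Finset.sum_const, Finset.card_erase_of_mem hw, hcard, hwd]
      simp only [add_tsub_cancel_right, nsmul_eq_mul, pow_succ, ← hss]
      apply le_of_eq
      field_simp
      ring
    · push Not at hex
      have hrest : ∀ x ∈ G.neighborFinset v, s⁻¹ ^ G.dist ρ x = s⁻¹ ^ (G.dist ρ v + 1) := by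
        intro x hx
        rcases hG.dist_eq_dist_add_one_of_adj ρ (show G.Adj v x by simpa using hx) with h | h
        · exact absurd h (hex x hx)
        · rw [h]
      rw [Finset.sum_congr rfl hrest, Finset.sum_const, hcard, pow_succ', nsmul_eq_mul,
        ← mul_assoc]
      refine mul_le_mul_of_nonneg_right ?_ (by positivity)
      rw [← div_eq_mul_inv, div_le_iff₀ hs0]
      push_cast
      nlinarith
  rw [tsum_eq_sum (s := G.neighborFinset v) fun w hw => by
    rw [stepPMF_apply_of_degree G hreg, if_neg hw, zero_mul]]
  calc ∑ w ∈ G.neighborFinset v, stepPMF G v w * ENNReal.ofReal (s⁻¹ ^ G.dist ρ w)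
      = ∑ w ∈ G.neighborFinset v, ENNReal.ofReal ((d + 1 : ℝ)⁻¹ * s⁻¹ ^ G.dist ρ w) := by
        refine Finset.sum_congr rfl fun w hw => ?_
        rw [stepPMF_apply_of_degree G hreg, if_pos hw, ENNReal.ofReal_mul (by positivity),
          ENNReal.ofReal_inv_of_pos (by positivity), ENNReal.ofReal_add (by positivity) zero_le_one]
        simp
    _ = ENNReal.ofReal ((d + 1 : ℝ)⁻¹ * ∑ w ∈ G.neighborFinset v, s⁻¹ ^ G.dist ρ w) := by
        rw [← ENNReal.ofReal_sum_of_nonneg fun w _ => by positivity, Finset.mul_sum]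
    _ ≤ ENNReal.ofReal ((d + 1 : ℝ)⁻¹ * (2 * s * s⁻¹ ^ G.dist ρ v)) := by gcongr
    _ = _ := by
        rw [← ENNReal.ofReal_mul (by positivity)]
        congr 1
        ring

end Tree

/-! ### Activation chains and a deterministic criterion for transience -/

section Deterministic

variable {V : Type*}

/-- Some frog of `u` visits `w` after at least one step. -/
def Hits (η : V → ℕ) (S : V → ℕ → ℕ → V) (u w : V) : Prop :=
  ∃ i < η u, ∃ n, S u i (n + 1) = w

/-- There is a chain of `n` steps of the relation `R` from `u` to `v` through distinct vertices, all
of which but the first lie outside `T`. -/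
def SimpleChain (R : V → V → Prop) : ℕ → V → Set V → V → Prop
  | 0, u, _, v => u = v
  | n + 1, u, T, v => ∃ w, w ∉ insert u T ∧ R u w ∧ SimpleChain R n w (insert u T) v

lemma SimpleChain.mono {R R' : V → V → Prop} (h : ∀ x y, R x y → R' x y) {n : ℕ} {u v : V}
    {T : Set V} (hc : SimpleChain R n u T v) : SimpleChain R' n u T v := by
  induction n generalizing u T with
  | zero => exact hc
  | succ n ih =>
    obtain ⟨w, hw, hR, hc⟩ := hc
    exact ⟨w, hw, h _ _ hR, ih hc⟩

lemma SimpleChain.append {R : V → V → Prop} {A : Set V} {n : ℕ} {u v y : V} {T : Set V}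
    (hc : SimpleChain (fun a b => R a b ∧ b ∈ A) n u T v) (hu : u ∈ A) (hyA : y ∉ A)
    (hyT : y ∉ T) (hR : R v y) : SimpleChain R (n + 1) u T y := by
  induction n generalizing u T with
  | zero =>
    obtain rfl : u = v := hc
    refine ⟨y, ?_, hR, rfl⟩
    rintro (rfl | h)
    exacts [hyA hu, hyT h]
  | succ n ih =>
    obtain ⟨w, hw, hRw, hc⟩ := hc
    refine ⟨w, hw, hRw.1, ih hc hRw.2 ?_⟩
    rintro (rfl | h)
    exacts [hyA hu, hyT h]

variable {ρ : V} {η : V → ℕ} {S : V → ℕ → ℕ → V}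

lemma active_succ_of_active {n : ℕ} {u : V} {i s : ℕ} (h : (u, i, s) ∈ active ρ η S n) :
    (u, i, s + 1) ∈ active ρ η S (n + 1) :=
  Or.inl ⟨u, i, s, h, rfl⟩

lemma active_add_of_active {n : ℕ} {u : V} {i s : ℕ} (h : (u, i, s) ∈ active ρ η S n) (k : ℕ) :
    (u, i, s + k) ∈ active ρ η S (n + k) := by
  induction k with
  | zero => exact h
  | succ k ih => exact active_succ_of_active ih

lemma lt_of_active {n : ℕ} {u : V} {i s : ℕ} (h : (u, i, s) ∈ active ρ η S n) : i < η u := by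
  induction n generalizing u i s with
  | zero =>
    obtain ⟨h1, h2, -⟩ := h
    simp only at h1 h2
    rwa [h1]
  | succ n ih =>
    rcases h with ⟨u', i', s', h, he⟩ | ⟨v, i', he, hi, -⟩
    · simp only [Prod.mk.injEq] at he
      obtain ⟨rfl, rfl, rfl⟩ := he
      exact ih h
    · simp only [Prod.mk.injEq] at he
      obtain ⟨rfl, rfl, rfl⟩ := he
      exact hi

lemma exists_root_active {n : ℕ} {u : V} {i s : ℕ} (h : (u, i, s) ∈ active ρ η S n) :
    ∃ j t, (ρ, j, t) ∈ active ρ η S n := by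
  induction n generalizing u i s with
  | zero =>
    have h1 : u = ρ := h.1
    subst h1
    exact ⟨_, _, h⟩
  | succ n ih =>
    rcases h with ⟨u', i', s', h, -⟩ | ⟨v, i', -, -, -, u', j, s', h, -⟩ <;>
    · obtain ⟨j, t, h⟩ := ih h
      exact ⟨j, t + 1, active_succ_of_active h⟩

lemma active_steps_unique {n : ℕ} {u : V} {i j s t : ℕ} (h : (u, i, s) ∈ active ρ η S n)
    (h' : (u, j, t) ∈ active ρ η S n) : s = t := by
  induction n generalizing i j s t with
  | zero => exact (show s = 0 from h.2.2).trans (show t = 0 from h'.2.2).symm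
  | succ n ih =>
    rcases h with ⟨u1, i1, s1, h, he⟩ | ⟨v1, i1, he, -, hn, -⟩ <;>
    rcases h' with ⟨u2, i2, s2, h', he'⟩ | ⟨v2, i2, he', -, hn', -⟩ <;>
    simp only [Prod.mk.injEq] at he he' <;>
    obtain ⟨rfl, rfl, rfl⟩ := he <;>
    obtain ⟨rfl, rfl, rfl⟩ := he'
    · rw [ih h h']
    · exact absurd h (hn' _ _)
    · exact absurd h' (hn _ _)
    · rfl

lemma active_time_sub_steps {n n' : ℕ} {u : V} {i j s t : ℕ} (h : (u, i, s) ∈ active ρ η S n)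
    (h' : (u, j, t) ∈ active ρ η S n') : n + t = n' + s := by
  have e1 := active_add_of_active h n'
  have e2 := active_add_of_active h' n
  rw [add_comm n' n] at e2
  have := active_steps_unique e1 e2
  omega

/-- Induction on time. Keeping the whole chain inside the set of sites awake at time n makes it stay
simple when extended: a newly woken site lies outside that set. -/
lemma exists_simpleChain_of_active {n : ℕ} {u : V} {i s : ℕ} (h : (u, i, s) ∈ active ρ η S n) :
    ∃ k, SimpleChain (fun a b => Hits η S a b ∧ b ∈ {x | ∃ j t, (x, j, t) ∈ active ρ η S n})
      k ρ ∅ u := by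
  induction n generalizing u i s with
  | zero => exact ⟨0, (show u = ρ from h.1).symm⟩
  | succ n ih =>
    have hmono : ∀ x, (∃ j t, (x, j, t) ∈ active ρ η S n) →
        ∃ j t, (x, j, t) ∈ active ρ η S (n + 1) := fun x ⟨j, t, hx⟩ =>
      ⟨j, t + 1, active_succ_of_active hx⟩
    have huact : ∃ j t, (u, j, t) ∈ active ρ η S (n + 1) := ⟨i, s, h⟩
    rcases h with ⟨u', i', s', h, he⟩ | ⟨v, i', he, -, hn, u', j, s', h, hS⟩ <;>
    simp only [Prod.mk.injEq] at he <;>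
    obtain ⟨rfl, rfl, rfl⟩ := he
    · obtain ⟨k, hk⟩ := ih h
      exact ⟨k, hk.mono fun x y hxy => ⟨hxy.1, hmono y hxy.2⟩⟩
    · obtain ⟨k, hk⟩ := ih h
      refine ⟨k + 1, SimpleChain.append (A := {x | ∃ j t, (x, j, t) ∈ active ρ η S n})
        (hk.mono fun x y hxy => ⟨⟨hxy.1, hmono y hxy.2⟩, hxy.2⟩) (exists_root_active h) ?_ (by simp)
        ⟨⟨j, lt_of_active h, s', hS⟩, huact⟩⟩
      rintro ⟨j, t, hu⟩
      exact hn j t hu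

/-- If every frog visits the root finitely often, and only finitely many sites that are reached by a
chain of activations send a frog to the root, then the realization is transient. -/
lemma isTransient_of_finite (h0 : ∀ u i, S u i 0 = u) (h1 : ∀ u i, {n | S u i n = ρ}.Finite)
    (h2 : {v | v ≠ ρ ∧ ∃ n, SimpleChain (Hits η S) n ρ ∅ v ∧ Hits η S v ρ}.Finite) :
    IsTransient ρ η S := by
  rw [IsTransient, IsRecurrent, Set.not_infinite]
  set F := {v | v ≠ ρ ∧ ∃ n, SimpleChain (Hits η S) n ρ ∅ v ∧ Hits η S v ρ}
  have hfin : ∀ u i, {n | ∃ s, (u, i, s) ∈ active ρ η S n ∧ S u i s = ρ}.Finite := by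
    intro u i
    rcases Set.eq_empty_or_nonempty {n | ∃ s, (u, i, s) ∈ active ρ η S n ∧ S u i s = ρ} with h | h
    · rw [h]; exact Set.finite_empty
    · obtain ⟨n₁, s₁, ha, -⟩ := h
      obtain ⟨b, hb⟩ := (h1 u i).bddAbove
      refine (Set.finite_Iic (n₁ + b)).subset ?_
      rintro n ⟨s, has, hs⟩
      have := active_time_sub_steps has ha
      have := hb hs
      simp only [Set.mem_Iic]
      omega
  refine Set.Finite.subset (s := ⋃ u ∈ insert ρ F, ⋃ i ∈ Set.Iio (η u),
    (fun n => (n, u, i)) '' {n | ∃ s, (u, i, s) ∈ active ρ η S n ∧ S u i s = ρ}) ?_ ?_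
  · exact (h2.insert ρ).biUnion fun u _ => (Set.finite_Iio _).biUnion fun i _ =>
      (hfin u i).image _
  · rintro ⟨n, u, i⟩ ⟨s, ha, hs⟩
    simp only at ha hs
    have hi := lt_of_active ha
    simp only [Set.mem_iUnion]
    refine ⟨u, ?_, i, hi, n, ⟨s, ha, hs⟩, rfl⟩
    by_cases hu : u = ρ
    · exact Or.inl hu
    · right
      obtain ⟨k, hk⟩ := exists_simpleChain_of_active ha
      refine ⟨hu, k, hk.mono fun _ _ h => h.1, i, hi, ?_⟩
      -- `Hits` requires at least one step; a visit at step 0 would mean u = ρ.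
      cases s with
      | zero => exact absurd ((h0 u i).symm.trans hs) hu
      | succ s => exact ⟨s, hs⟩

end Deterministic

/-! ### Independence of the data attached to different sites -/

section Independence

/-- Independent families on two factors give an independent family of pairs on the product. -/
lemma iIndepFun_prodMk_prod {ι Ω Ω' : Type*} {α β : ι → Type*} {mΩ : MeasurableSpace Ω}
    {mΩ' : MeasurableSpace Ω'} {mα : ∀ i, MeasurableSpace (α i)} {mβ : ∀ i, MeasurableSpace (β i)}
    {P : Measure Ω} {P' : Measure Ω'} [IsProbabilityMeasure P] [IsProbabilityMeasure P']
    {X : ∀ i, Ω → α i} {Y : ∀ i, Ω' → β i} (hX : iIndepFun X P) (hY : iIndepFun Y P')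
    (mX : ∀ i, Measurable (X i)) (mY : ∀ i, Measurable (Y i)) :
    iIndepFun (fun i (ω : Ω × Ω') => (X i ω.1, Y i ω.2)) (P.prod P') := by
  rw [iIndepFun_iff_measure_inter_preimage_eq_mul]
  intro s A hA
  have hA' : ∀ i ∈ s, MeasurableSet ((fun ω : Ω × Ω' => (X i ω.1, Y i ω.2)) ⁻¹' A i) :=
    fun i hi => (by fun_prop : Measurable fun ω : Ω × Ω' => (X i ω.1, Y i ω.2)) (hA i hi)
  classical
  -- Fubini: for fixed first coordinate, independence of Y gives a product of functions of the X i.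
  -- The value 0 off `s` keeps every `g i` measurable, since `A i` is known to be measurable only
  -- for i in `s`.
  set g : ∀ i, α i → ℝ≥0∞ := fun i a =>
    if i ∈ s then P' (Y i ⁻¹' (Prod.mk a ⁻¹' A i)) else 0 with hg
  have hgm : ∀ i, Measurable (g i) := by
    intro i
    by_cases hi : i ∈ s
    · simp only [hg, if_pos hi]
      have hB : MeasurableSet ((fun q : α i × Ω' => (q.1, Y i q.2)) ⁻¹' A i) :=
        (by fun_prop : Measurable fun q : α i × Ω' => (q.1, Y i q.2)) (hA i hi)
      exact measurable_measure_prodMk_left hB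
    · simp only [hg, if_neg hi]
      exact measurable_const
  rw [Measure.prod_apply (Finset.measurableSet_biInter s hA')]
  have h1 : ∀ ω, P' (Prod.mk ω ⁻¹' ⋂ i ∈ s, (fun ω : Ω × Ω' => (X i ω.1, Y i ω.2)) ⁻¹' A i) =
      ∏ i ∈ s, g i (X i ω) := by
    intro ω
    have h2 := hY.measure_inter_preimage_eq_mul s
      (sets := fun i => Prod.mk (X i ω) ⁻¹' A i) fun i hi => measurable_prodMk_left (hA i hi)
    rw [Finset.prod_congr rfl fun i hi => (by simp [hg, hi] :
      g i (X i ω) = P' (Y i ⁻¹' (Prod.mk (X i ω) ⁻¹' A i))), ← h2]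
    congr 1
    ext ω'
    simp
  simp only [h1]
  rw [lintegral_prod_eq_prod_lintegral_of_indepFun s (fun i ω => g i (X i ω))
    (hX.comp g hgm) fun i => (hgm i).comp (mX i)]
  refine Finset.prod_congr rfl fun i hi => ?_
  rw [Measure.prod_apply (hA' i hi)]
  simp only [hg, if_pos hi]
  rfl

variable {V : Type*} (G : SimpleGraph V) [G.LocallyFinite]
variable [MeasurableSpace V] [DiscreteMeasurableSpace V]

lemma iIndepFun_walksLaw :
    iIndepFun (fun u (ω : V × ℕ → ℕ → V) i => ω (u, i)) (walksLaw G) := by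
  have : IsProbabilityMeasure (walksLaw G) := by unfold walksLaw; infer_instance
  rw [iIndepFun_iff_map_fun_eq_infinitePi_map (by fun_prop)]
  have h := Measure.infinitePi_map_curry (fun (u : V) (_ : ℕ) => walkLaw G u)
  have h2 : ∀ u, (walksLaw G).map (fun ω i => ω (u, i)) =
      Measure.infinitePi fun _ : ℕ => walkLaw G u := fun u =>
    Measure.map_infinitePi_infinitePi_of_inj (P := fun p : V × ℕ => walkLaw G p.1)
      (f := fun i : ℕ => (u, i)) fun i j hij => by simpa using hij
  simp only [h2]
  exact h

/-- The initial count and the walks of the frogs of the site `u`. -/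
def siteData (u : V) (ω : (V → ℕ) × (V × ℕ → ℕ → V)) : ℕ × (ℕ → ℕ → V) :=
  (ω.1 u, fun i => ω.2 (u, i))

omit [DiscreteMeasurableSpace V] in
lemma measurable_siteData (u : V) : Measurable (siteData u) := by
  unfold siteData
  fun_prop

/-- The sigma-algebra generated by the frogs of the site `u`. -/
abbrev siteAlgebra (u : V) : MeasurableSpace ((V → ℕ) × (V × ℕ → ℕ → V)) :=
  MeasurableSpace.comap (siteData u) inferInstance

lemma iIndepFun_siteData (ρ : V) (ν₀ ν : Measure ℕ) [IsProbabilityMeasure ν₀]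
    [IsProbabilityMeasure ν] : iIndepFun siteData (frogLaw G ρ ν₀ ν) := by
  classical
  have h : ∀ v : V, IsProbabilityMeasure (if v = ρ then ν₀ else ν) := fun v => by
    split_ifs <;> infer_instance
  have h1 : IsProbabilityMeasure (walksLaw G) := by unfold walksLaw; infer_instance
  have h2 : IsProbabilityMeasure (countLaw ρ ν₀ ν) := by unfold countLaw; infer_instance
  have hX : iIndepFun (fun (u : V) (η : V → ℕ) => η u) (countLaw ρ ν₀ ν) := by
    unfold countLaw
    convert iIndepFun_infinitePi (P := fun v : V => if v = ρ then ν₀ else ν)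
      (X := fun _ k => k) (by fun_prop)
  exact iIndepFun_prodMk_prod hX (iIndepFun_walksLaw G) (by fun_prop) (by fun_prop)

end Independence

/-! ### First-moment bounds along chains -/

section Chains

variable {V : Type*} (G : SimpleGraph V) [G.LocallyFinite]
variable [MeasurableSpace V] [DiscreteMeasurableSpace V]

/-- The event that some frog of `u` visits `w` after at least one step. -/
def hitsEvent (u w : V) : Set ((V → ℕ) × (V × ℕ → ℕ → V)) :=
  {ω | Hits ω.1 (fun v i => ω.2 (v, i)) u w}

/-- The event that there is a chain of `n` activations from `u` to `v` avoiding `T`, and that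
some frog of `v` visits `ρ`. -/
def returnEvent (ρ : V) (n : ℕ) (u : V) (T : Set V) (v : V) :
    Set ((V → ℕ) × (V × ℕ → ℕ → V)) :=
  {ω | SimpleChain (Hits ω.1 (fun v i => ω.2 (v, i))) n u T v ∧
    Hits ω.1 (fun v i => ω.2 (v, i)) v ρ}

lemma measurableSet_hitsEvent (u w : V) : MeasurableSet[siteAlgebra u] (hitsEvent u w) := by
  refine ⟨⋃ i, ⋃ n, {p | i < p.1} ∩ {p | p.2 i (n + 1) = w}, ?_, ?_⟩
  · refine MeasurableSet.iUnion fun i => MeasurableSet.iUnion fun n => MeasurableSet.inter ?_ ?_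
    · exact measurable_fst (MeasurableSet.of_discrete (s := {k : ℕ | i < k}))
    · exact (by fun_prop : Measurable fun p : ℕ × (ℕ → ℕ → V) => p.2 i (n + 1))
        (measurableSet_singleton w)
  · ext ω
    simp [hitsEvent, Hits, siteData]

omit [MeasurableSpace V] [DiscreteMeasurableSpace V] in
lemma returnEvent_zero_self (ρ u : V) (T : Set V) :
    returnEvent ρ 0 u T u = hitsEvent u ρ := by
  ext ω
  simp [returnEvent, SimpleChain, hitsEvent]

omit [MeasurableSpace V] [DiscreteMeasurableSpace V] in
lemma returnEvent_zero_of_ne (ρ : V) {u v : V} (h : u ≠ v) (T : Set V) :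
    returnEvent ρ 0 u T v = ∅ := by
  ext ω
  simp [returnEvent, SimpleChain, h]

omit [MeasurableSpace V] [DiscreteMeasurableSpace V] in
lemma returnEvent_succ (ρ : V) (n : ℕ) (u : V) (T : Set V) (v : V) :
    returnEvent ρ (n + 1) u T v =
      ⋃ w, ⋃ _ : w ∉ insert u T, hitsEvent u w ∩ returnEvent ρ n w (insert u T) v := by
  ext ω
  simp only [returnEvent, SimpleChain, hitsEvent, Set.mem_iUnion]
  constructor
  · rintro ⟨⟨w, hw, h1, h2⟩, h3⟩
    exact ⟨w, hw, h1, h2, h3⟩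
  · rintro ⟨w, hw, h1, h2, h3⟩
    exact ⟨⟨w, hw, h1, h2⟩, h3⟩

/-- A chain from u avoiding T consults only frogs at its own sites, all outside T; the final visit
to ρ consults frogs of v, not those of ρ. -/
lemma measurableSet_returnEvent [Countable V] (ρ : V) (n : ℕ) {u : V} {T : Set V} (hu : u ∉ T)
    (v : V) :
    MeasurableSet[⨆ x ∈ Tᶜ, siteAlgebra x] (returnEvent ρ n u T v) := by
  have hle : ∀ {u : V} {T : Set V}, u ∉ T →
      siteAlgebra u ≤ ⨆ x ∈ Tᶜ, siteAlgebra x := fun {u T} hu =>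
    le_iSup₂_of_le u hu le_rfl
  induction n generalizing u T with
  | zero =>
    by_cases h : u = v
    · subst h
      rw [returnEvent_zero_self]
      exact hle hu _ (measurableSet_hitsEvent u ρ)
    · rw [returnEvent_zero_of_ne ρ h]
      exact @MeasurableSet.empty _ (_)
  | succ n ih =>
    rw [returnEvent_succ]
    refine @MeasurableSet.iUnion _ _ (_) _ _ fun w => @MeasurableSet.iUnion _ _ (_) _ _ fun hw =>
      @MeasurableSet.inter _ (_) _ _ (hle hu _ (measurableSet_hitsEvent u w)) ?_
    have hmono : (⨆ x ∈ (insert u T)ᶜ, siteAlgebra x) ≤ ⨆ x ∈ Tᶜ, siteAlgebra (V := V) x :=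
      biSup_mono fun x hx hxT => hx (Or.inr hxT)
    exact hmono _ (ih hw)

variable (ρ : V) (ν₀ ν : Measure ℕ) [IsProbabilityMeasure ν₀] [IsProbabilityMeasure ν]

lemma measure_inter_returnEvent [Countable V] {D : Set ((V → ℕ) × (V × ℕ → ℕ → V))} {u : V}
    (hD : MeasurableSet[siteAlgebra u] D) (n : ℕ) {w : V} {T : Set V} (hw : w ∉ insert u T)
    (v : V) :
    frogLaw G ρ ν₀ ν (D ∩ returnEvent ρ n w (insert u T) v) =
      frogLaw G ρ ν₀ ν D * frogLaw G ρ ν₀ ν (returnEvent ρ n w (insert u T) v) := by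
  have h := indep_iSup_of_disjoint (fun x => (measurable_siteData x).comap_le)
    (iIndepFun_siteData G ρ ν₀ ν).iIndep (S := {u}) (T := (insert u T)ᶜ) (by simp)
  refine (Indep_iff _ _ _).1 h _ _ ?_ (measurableSet_returnEvent ρ n hw v)
  exact le_iSup₂_of_le (f := fun x (_ : x ∈ ({u} : Set V)) => siteAlgebra x) u rfl le_rfl _ hD

/-- Union bound over the first site w of the chain, followed by independence of the first link from
the rest. The event D is carried along so that the count at ρ can be truncated. -/
lemma tsum_measure_inter_returnEvent_succ_le [Countable V] {W : V → ℝ≥0∞} {n : ℕ} {u : V}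
    {T : Set V} {D : Set ((V → ℕ) × (V × ℕ → ℕ → V))} (hD : MeasurableSet[siteAlgebra u] D)
    (hW : ∀ w ∉ insert u T, ∑' v, frogLaw G ρ ν₀ ν (returnEvent ρ n w (insert u T) v) ≤ W w) :
    ∑' v, frogLaw G ρ ν₀ ν (D ∩ returnEvent ρ (n + 1) u T v) ≤
      ∑' w, frogLaw G ρ ν₀ ν (D ∩ hitsEvent u w) * W w := by
  classical
  calc ∑' v, frogLaw G ρ ν₀ ν (D ∩ returnEvent ρ (n + 1) u T v)
      ≤ ∑' v, ∑' w, frogLaw G ρ ν₀ ν (D ∩ hitsEvent u w) * (if w ∉ insert u T then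
          frogLaw G ρ ν₀ ν (returnEvent ρ n w (insert u T) v) else 0) := by
        refine ENNReal.tsum_le_tsum fun v => ?_
        rw [returnEvent_succ, Set.inter_iUnion]
        refine (measure_iUnion_le _).trans (ENNReal.tsum_le_tsum fun w => ?_)
        by_cases hw : w ∉ insert u T
        · rw [if_pos hw, ← measure_inter_returnEvent G ρ ν₀ ν
            (@MeasurableSet.inter _ (_) _ _ hD (measurableSet_hitsEvent u w)) n hw]
          simp [hw, Set.inter_assoc]
        · simp only [hw, if_false, Set.iUnion_false, Set.inter_empty, measure_empty, mul_zero, le_refl]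
    _ = ∑' w, frogLaw G ρ ν₀ ν (D ∩ hitsEvent u w) * ∑' v, (if w ∉ insert u T then
          frogLaw G ρ ν₀ ν (returnEvent ρ n w (insert u T) v) else 0) := by
        rw [ENNReal.tsum_comm]
        simp only [ENNReal.tsum_mul_left]
    _ ≤ _ := by
        refine ENNReal.tsum_le_tsum fun w => ?_
        gcongr
        by_cases hw : w ∉ insert u T
        · simp only [if_pos hw]; exact hW w hw
        · simp only [hw, if_false, tsum_zero, zero_le]

/-- Each link costs a factor θ, and so does the final visit to ρ, whence the exponent n + 1. Having
ρ in T keeps the chain off ρ, where no contraction is assumed. -/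
lemma tsum_measure_returnEvent_le [Countable V] {W : V → ℝ≥0∞} (hρ : 1 ≤ W ρ) {θ : ℝ≥0∞}
    (hθ : ∀ u ≠ ρ, ∑' w, frogLaw G ρ ν₀ ν (hitsEvent u w) * W w ≤ θ * W u) (n : ℕ) {u : V}
    {T : Set V} (hρT : ρ ∈ T) (hu : u ∉ T) :
    ∑' v, frogLaw G ρ ν₀ ν (returnEvent ρ n u T v) ≤ θ ^ (n + 1) * W u := by
  have hne : ∀ {u : V} {T : Set V}, ρ ∈ T → u ∉ T → u ≠ ρ := by
    rintro u T h1 h2 rfl; exact h2 h1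
  induction n generalizing u T with
  | zero =>
    rw [tsum_eq_single u fun v hv => by rw [returnEvent_zero_of_ne ρ hv.symm, measure_empty],
      returnEvent_zero_self, zero_add, pow_one]
    refine le_trans ?_ (hθ u (hne hρT hu))
    refine le_trans ?_ (ENNReal.le_tsum ρ)
    exact le_mul_of_one_le_right' hρ
  | succ n ih =>
    have h := tsum_measure_inter_returnEvent_succ_le G ρ ν₀ ν (W := fun w => θ ^ (n + 1) * W w)
      (n := n) (T := T) (D := Set.univ) (u := u) (@MeasurableSet.univ _ (_))
      fun w hw => ih (Or.inr hρT) hw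
    simp only [Set.univ_inter] at h
    refine h.trans ?_
    calc ∑' w, frogLaw G ρ ν₀ ν (hitsEvent u w) * (θ ^ (n + 1) * W w)
        = θ ^ (n + 1) * ∑' w, frogLaw G ρ ν₀ ν (hitsEvent u w) * W w := by
          rw [← ENNReal.tsum_mul_left]; congr with w; ring
      _ ≤ θ ^ (n + 1) * (θ * W u) := by gcongr; exact hθ u (hne hρT hu)
      _ = θ ^ (n + 1 + 1) * W u := by ring

/-- The count at ρ may have infinite mean, so the sum of probabilities is bounded on each event
{η(ρ) ≤ k} separately, by a geometric series in θ. Borel–Cantelli applies for every k, and k = η(ρ)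
is chosen afterwards for each realization. -/
lemma ae_finite_return [Countable V] {W : V → ℝ≥0∞} (hρ : 1 ≤ W ρ) {θ : ℝ≥0∞} (hθ1 : θ < 1)
    (hθ : ∀ u ≠ ρ, ∑' w, frogLaw G ρ ν₀ ν (hitsEvent u w) * W w ≤ θ * W u)
    (hroot : ∀ k : ℕ, ∑' w, frogLaw G ρ ν₀ ν ({ω | ω.1 ρ ≤ k} ∩ hitsEvent ρ w) * W w ≠ ⊤) :
    ∀ᵐ ω ∂(frogLaw G ρ ν₀ ν),
      {v | v ≠ ρ ∧ ∃ n, SimpleChain (Hits ω.1 (fun v i => ω.2 (v, i))) n ρ ∅ v ∧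
        Hits ω.1 (fun v i => ω.2 (v, i)) v ρ}.Finite := by
  have key : ∀ k : ℕ, ∀ᵐ ω ∂(frogLaw G ρ ν₀ ν),
      {v | ω ∈ ⋃ n, ({ω | ω.1 ρ ≤ k} ∩ returnEvent ρ (n + 1) ρ ∅ v)}.Finite := by
    intro k
    refine ae_finite_setOfPred_mem (ne_top_of_le_ne_top ?_
      (ENNReal.tsum_le_tsum fun v => measure_iUnion_le _))
    rw [ENNReal.tsum_comm]
    have hD : MeasurableSet[siteAlgebra ρ]
        {ω : (V → ℕ) × (V × ℕ → ℕ → V) | ω.1 ρ ≤ k} :=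
      ⟨{p | p.1 ≤ k}, measurable_fst (MeasurableSet.of_discrete (s := {j : ℕ | j ≤ k})), rfl⟩
    have hn : ∀ n, ∑' v, frogLaw G ρ ν₀ ν ({ω | ω.1 ρ ≤ k} ∩ returnEvent ρ (n + 1) ρ ∅ v) ≤
        (θ * ∑' w, frogLaw G ρ ν₀ ν ({ω | ω.1 ρ ≤ k} ∩ hitsEvent ρ w) * W w) * θ ^ n := by
      intro n
      refine (tsum_measure_inter_returnEvent_succ_le G ρ ν₀ ν (T := ∅) hD
        (W := fun w => θ ^ (n + 1) * W w) fun w hw =>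
          tsum_measure_returnEvent_le G ρ ν₀ ν hρ hθ n (by simp) hw).trans (le_of_eq ?_)
      rw [mul_right_comm, ← pow_succ', ← ENNReal.tsum_mul_left]
      congr with w; ring
    refine ne_top_of_le_ne_top ?_ (ENNReal.tsum_le_tsum hn)
    rw [ENNReal.tsum_mul_left, ENNReal.tsum_geometric]
    refine ENNReal.mul_ne_top (ENNReal.mul_ne_top hθ1.ne_top (hroot k)) ?_
    rw [ENNReal.inv_ne_top]
    exact (tsub_pos_of_lt hθ1).ne'
  filter_upwards [ae_all_iff.2 key] with ω hω
  refine (hω (ω.1 ρ)).subset ?_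
  rintro v ⟨hv, n, hc, hh⟩
  cases n with
  | zero => exact absurd (show ρ = v from hc).symm hv
  | succ n => exact Set.mem_iUnion.2 ⟨n, ⟨le_refl (ω.1 ρ), hc, hh⟩⟩

end Chains

/-! ### Hitting probabilities in terms of transition probabilities -/

section Bounds

variable {V : Type*} (G : SimpleGraph V) [G.LocallyFinite]
variable [MeasurableSpace V] [DiscreteMeasurableSpace V]

instance : IsProbabilityMeasure (walksLaw G) := by unfold walksLaw; infer_instance

omit [MeasurableSpace V] [DiscreteMeasurableSpace V] in
lemma map_eval_countLaw (ρ u : V) (ν₀ ν : Measure ℕ) [IsProbabilityMeasure ν₀]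
    [IsProbabilityMeasure ν] [Decidable (u = ρ)] :
    (countLaw ρ ν₀ ν).map (fun η => η u) = if u = ρ then ν₀ else ν := by
  classical
  have h : ∀ v : V, IsProbabilityMeasure (if v = ρ then ν₀ else ν) := fun v => by
    split_ifs <;> infer_instance
  unfold countLaw
  convert Measure.infinitePi_map_eval (fun v : V => if v = ρ then ν₀ else ν) u

lemma walksLaw_eval (u : V) (i : ℕ) : (walksLaw G).map (fun ω => ω (u, i)) = walkLaw G u :=
  Measure.infinitePi_map_eval (fun p : V × ℕ => walkLaw G p.1) (u, i)

lemma walksLaw_visit_le (u w : V) (k n : ℕ) :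
    walksLaw G {ω | ∃ i < k, ω (u, i) n = w} ≤ min 1 (k * transProb G n u w) := by
  refine le_min prob_le_one ?_
  have h : {ω : V × ℕ → ℕ → V | ∃ i < k, ω (u, i) n = w} =
      ⋃ i ∈ Finset.range k, (fun ω : V × ℕ → ℕ → V => ω (u, i)) ⁻¹' {S | S n = w} := by
    ext ω; simp
  rw [h]
  refine (measure_biUnion_finset_le _ _).trans (le_of_eq ?_)
  rw [Finset.sum_congr rfl fun i _ => by
    rw [← Measure.map_apply (by fun_prop) (measurableSet_eval_eq n w), walksLaw_eval G u i]]
  simp [transProb]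

/-- Union bound over the time of the visit, then over the frogs. The minimum with 1 is retained
because the count may have infinite mean. The set K serves to truncate the count at ρ. -/
lemma measure_hitsEvent_le (ρ u w : V) (ν₀ ν : Measure ℕ) [IsProbabilityMeasure ν₀]
    [IsProbabilityMeasure ν] [Decidable (u = ρ)] (K : Set ℕ) :
    frogLaw G ρ ν₀ ν ({ω | ω.1 u ∈ K} ∩ hitsEvent u w) ≤
      ∑' n, ∫⁻ k in K, min 1 (k * transProb G (n + 1) u w) ∂(if u = ρ then ν₀ else ν) := by
  have h2 : IsProbabilityMeasure (countLaw ρ ν₀ ν) := by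
    classical
    have h : ∀ v : V, IsProbabilityMeasure (if v = ρ then ν₀ else ν) := fun v => by
      split_ifs <;> infer_instance
    unfold countLaw; infer_instance
  have hK : MeasurableSet K := MeasurableSet.of_discrete
  have hsub : {ω | ω.1 u ∈ K} ∩ hitsEvent u w ⊆ ⋃ n,
      {ω : (V → ℕ) × (V × ℕ → ℕ → V) | ω.1 u ∈ K ∧ ∃ i < ω.1 u, ω.2 (u, i) (n + 1) = w} := by
    rintro ω ⟨hK, i, hi, n, hn⟩
    exact Set.mem_iUnion.2 ⟨n, hK, i, hi, hn⟩
  refine (measure_mono hsub).trans ((measure_iUnion_le _).trans (ENNReal.tsum_le_tsum fun n => ?_))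
  have hm : MeasurableSet
      {ω : (V → ℕ) × (V × ℕ → ℕ → V) | ω.1 u ∈ K ∧ ∃ i < ω.1 u, ω.2 (u, i) (n + 1) = w} := by
    have he : {ω : (V → ℕ) × (V × ℕ → ℕ → V) |
        ω.1 u ∈ K ∧ ∃ i < ω.1 u, ω.2 (u, i) (n + 1) = w} =
        ⋃ i, (fun ω => (ω.1 u, ω.2 (u, i) (n + 1))) ⁻¹' ({k | k ∈ K ∧ i < k} ×ˢ {w}) := by
      ext ω; simp [and_assoc]
    rw [he]
    refine MeasurableSet.iUnion fun i =>
      (by fun_prop : Measurable fun ω : (V → ℕ) × (V × ℕ → ℕ → V) =>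
        (ω.1 u, ω.2 (u, i) (n + 1))) ?_
    exact MeasurableSet.of_discrete.prod (measurableSet_singleton w)
  rw [frogLaw, Measure.prod_apply hm]
  set g : ℕ → ℝ≥0∞ := K.indicator fun k => min 1 (k * transProb G (n + 1) u w) with hg
  calc ∫⁻ η, walksLaw G (Prod.mk η ⁻¹' {ω : (V → ℕ) × (V × ℕ → ℕ → V) |
        ω.1 u ∈ K ∧ ∃ i < ω.1 u, ω.2 (u, i) (n + 1) = w}) ∂(countLaw ρ ν₀ ν)
      ≤ ∫⁻ η, g (η u) ∂(countLaw ρ ν₀ ν) := by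
        refine lintegral_mono fun η => ?_
        by_cases h : η u ∈ K
        · simp only [hg, Set.indicator_of_mem h]
          refine le_trans (measure_mono ?_) (walksLaw_visit_le G u w (η u) (n + 1))
          exact fun ω hω => hω.2
        · refine (le_of_eq ?_).trans zero_le
          convert measure_empty (μ := walksLaw G)
          ext ω
          simp [h]
    _ = _ := by
        rw [← lintegral_map (μ := countLaw ρ ν₀ ν) (g := fun η : V → ℕ => η u)
          Measurable.of_discrete (by fun_prop), map_eval_countLaw, hg, lintegral_indicator hK]

end Bounds

/-! ### From contraction to transience -/

section Transience

variable {V : Type*} [MeasurableSpace V] [DiscreteMeasurableSpace V]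

/-- Interpolation: min(1, y) ≤ y^a, and p^a = p · p^(-(1-a)) ≤ p · c^(-(1-a)) when p ≥ c. -/
lemma min_one_mul_le_rpow {x p c : ℝ≥0∞} {a : ℝ} (ha0 : 0 < a) (ha1 : a ≤ 1) (hc0 : c ≠ 0)
    (hct : c ≠ ⊤) (hp : p = 0 ∨ c ≤ p) (hpt : p ≠ ⊤) :
    min 1 (x * p) ≤ x ^ a * (p * (c ^ (1 - a))⁻¹) := by
  rcases hp with rfl | hp
  · simp
  have hp0 : p ≠ 0 := fun h => hc0 (le_antisymm (h ▸ hp) zero_le)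
  have h1 : min 1 (x * p) ≤ (x * p) ^ a := by
    rcases le_total (x * p) 1 with h | h
    · rw [min_eq_right h]
      simpa using ENNReal.rpow_le_rpow_of_exponent_ge h ha1
    · rw [min_eq_left h]
      exact ENNReal.one_le_rpow h ha0
  refine h1.trans ?_
  rw [ENNReal.mul_rpow_of_nonneg _ _ ha0.le]
  gcongr
  rw [← div_eq_mul_inv, ENNReal.le_div_iff_mul_le (Or.inl (by simp [hc0, hct]))
    (Or.inl (by simp [hc0, hct]))]
  calc p ^ a * c ^ (1 - a) ≤ p ^ a * p ^ (1 - a) := by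
        gcongr
    _ = p := by rw [← ENNReal.rpow_add _ _ hp0 hpt]; simp

/-- The frog model is transient as soon as a suitable function `W` contracts. -/
lemma almostSurelyTransient_of_contraction (G : SimpleGraph V) [G.LocallyFinite] [Countable V]
    {d : ℕ} (hreg : G.IsRegularOfDegree (d + 1)) {ρ : V} {W : V → ℝ≥0∞} (hρ : W ρ = 1)
    (hWt : ∀ v, W v ≠ ⊤) {m θ lam : ℝ≥0∞} {a : ℝ} (ha0 : 0 < a) (ha1 : a ≤ 1)
    (hlam : lam = ((d : ℝ≥0∞) + 1) ^ (1 - a))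
    (hm : m < 1) (hW : ∀ v, ∑' w, stepPMF G v w * W w ≤ m * W v) (π : Measure ℕ)
    [IsProbabilityMeasure π] (hθ1 : θ < 1)
    (hθ : ∑' n : ℕ, m ^ (n + 1) + (∫⁻ k : ℕ, (k : ℝ≥0∞) ^ a ∂π) * ∑' n : ℕ, (lam * m) ^ (n + 1) ≤ θ)
    (ν₀ : Measure ℕ) [IsProbabilityMeasure ν₀] :
    AlmostSurelyTransient G ρ ν₀ (plusOne π) := by
  classical
  have hplus : IsProbabilityMeasure (plusOne π) :=
    Measure.isProbabilityMeasure_map Measurable.of_discrete.aemeasurable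
  have hp1 : ∀ n u w, transProb G n u w ≠ ⊤ := fun n u w => measure_ne_top _ _
  have hWn : ∀ n u, ∑' w, transProb G n u w * W w ≤ m ^ n * W u :=
    tsum_transProb_mul_le G W m hW
  have hd0 : ((d : ℝ≥0∞) + 1)⁻¹ ≠ 0 := ENNReal.inv_ne_zero.2 (by simp)
  have hdt : ((d : ℝ≥0∞) + 1)⁻¹ ≠ ⊤ := ENNReal.inv_ne_top.2 (by simp)
  have hgeo : ∑' n : ℕ, m ^ (n + 1) ≠ ⊤ := ne_top_of_le_ne_top hθ1.ne_top (le_self_add.trans hθ)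
  set M := ∫⁻ k : ℕ, (k : ℝ≥0∞) ^ a ∂π with hM
  -- The guaranteed frog contributes p and the k others at most k^a p λ^n, by interpolation with c =
  -- (d+1)^(-n).
  have hsite : ∀ n u w, ∫⁻ k, min 1 (k * transProb G n u w) ∂(plusOne π) ≤
      transProb G n u w * (1 + M * lam ^ n) := by
    intro n u w
    rw [plusOne, lintegral_map Measurable.of_discrete Measurable.of_discrete]
    calc ∫⁻ k : ℕ, min 1 (((k + 1 : ℕ) : ℝ≥0∞) * transProb G n u w) ∂π
        ≤ ∫⁻ k : ℕ, (transProb G n u w + (k : ℝ≥0∞) ^ a * (transProb G n u w * lam ^ n)) ∂π := by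
          refine lintegral_mono fun k => ?_
          have h := min_one_mul_le_rpow (x := k) ha0 ha1 (pow_ne_zero n hd0)
            (ENNReal.pow_ne_top hdt) (transProb_eq_zero_or_le G hreg n u w) (hp1 n u w)
          have hl : (((((d : ℝ≥0∞) + 1)⁻¹) ^ n) ^ (1 - a))⁻¹ = lam ^ n := by
            rw [hlam, ← ENNReal.rpow_natCast, ← ENNReal.rpow_mul, mul_comm, ENNReal.rpow_mul,
              ENNReal.rpow_natCast, ENNReal.inv_rpow, ENNReal.inv_pow, inv_inv]
          rw [hl] at h
          refine le_trans ?_ (add_le_add_right h _)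
          push_cast
          rw [add_mul, one_mul, add_comm]
          rcases le_total ((k : ℝ≥0∞) * transProb G n u w) 1 with h1 | h1
          · rw [min_eq_right h1]; exact min_le_right _ _
          · rw [min_eq_left h1]; exact (min_le_left _ _).trans le_add_self
      _ = transProb G n u w * (1 + M * lam ^ n) := by
          rw [lintegral_add_left measurable_const, lintegral_const, measure_univ, mul_one,
            lintegral_mul_const _ Measurable.of_discrete]
          ring
  have hne : ∀ u ≠ ρ, ∑' w, frogLaw G ρ ν₀ (plusOne π) (hitsEvent u w) * W w ≤ θ * W u := by
    intro u hu
    calc ∑' w, frogLaw G ρ ν₀ (plusOne π) (hitsEvent u w) * W w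
        ≤ ∑' w, ∑' n : ℕ, (transProb G (n + 1) u w * W w) * (1 + M * lam ^ (n + 1)) := by
          refine ENNReal.tsum_le_tsum fun w => ?_
          have h := measure_hitsEvent_le G ρ u w ν₀ (plusOne π) Set.univ
          simp only [Set.mem_univ, Set.ofPred_true, Set.univ_inter, if_neg hu,
            Measure.restrict_univ] at h
          calc _ ≤ (∑' n : ℕ, transProb G (n + 1) u w * (1 + M * lam ^ (n + 1))) * W w := by
                gcongr
                exact h.trans (ENNReal.tsum_le_tsum fun n => hsite (n + 1) u w)
            _ = _ := by
                rw [← ENNReal.tsum_mul_right]; congr with n; ring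
      _ = ∑' n : ℕ, (∑' w, transProb G (n + 1) u w * W w) * (1 + M * lam ^ (n + 1)) := by
          rw [ENNReal.tsum_comm]
          simp only [ENNReal.tsum_mul_right]
      _ ≤ ∑' n : ℕ, (m ^ (n + 1) * W u) * (1 + M * lam ^ (n + 1)) := by
          gcongr with n; exact hWn (n + 1) u
      _ = (∑' n : ℕ, m ^ (n + 1) + M * ∑' n : ℕ, (lam * m) ^ (n + 1)) * W u := by
          rw [← ENNReal.tsum_mul_left, ← ENNReal.tsum_add, ← ENNReal.tsum_mul_right]
          congr with n
          rw [mul_pow]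
          ring
      _ ≤ θ * W u := by gcongr
  have hroot : ∀ k : ℕ, ∑' w, frogLaw G ρ ν₀ (plusOne π) ({ω | ω.1 ρ ≤ k} ∩ hitsEvent ρ w) * W w
      ≠ ⊤ := by
    intro k
    refine ne_top_of_le_ne_top (ENNReal.mul_ne_top (ENNReal.natCast_ne_top k) hgeo) ?_
    calc ∑' w, frogLaw G ρ ν₀ (plusOne π) ({ω | ω.1 ρ ≤ k} ∩ hitsEvent ρ w) * W w
        ≤ ∑' w, ∑' n : ℕ, k * (transProb G (n + 1) ρ w * W w) := by
          refine ENNReal.tsum_le_tsum fun w => ?_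
          calc _ ≤ (∑' n : ℕ, k * transProb G (n + 1) ρ w) * W w := by
                gcongr
                refine (measure_hitsEvent_le G ρ ρ w ν₀ (plusOne π) (Set.Iic k)).trans
                  (ENNReal.tsum_le_tsum fun n => ?_)
                rw [if_pos rfl]
                calc _ ≤ ∫⁻ j in Set.Iic k, k * transProb G (n + 1) ρ w ∂ν₀ := by
                      refine setLIntegral_mono' MeasurableSet.of_discrete fun j hj => ?_
                      refine (min_le_right _ _).trans ?_
                      gcongr
                      exact hj
                  _ ≤ _ := by
                      rw [setLIntegral_const]
                      exact mul_le_of_le_one_right' prob_le_one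
            _ = _ := by
                rw [← ENNReal.tsum_mul_right]; congr with n; ring
      _ = ∑' n : ℕ, k * ∑' w, transProb G (n + 1) ρ w * W w := by
          rw [ENNReal.tsum_comm]
          simp only [ENNReal.tsum_mul_left]
      _ ≤ ∑' n : ℕ, k * (m ^ (n + 1) * W ρ) := by
          gcongr with n; exact hWn (n + 1) ρ
      _ = k * ∑' n : ℕ, m ^ (n + 1) := by
          simp only [hρ, mul_one, ENNReal.tsum_mul_left]
  have hret := ae_finite_return G ρ ν₀ (plusOne π) hρ.ge hθ1 hne hroot
  -- Since W ρ = 1, the probability of being at ρ after n steps is at most m^n W u, which is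
  -- summable.
  have hwalk : ∀ u, ∀ᵐ S ∂(walkLaw G u), S 0 = u ∧ {n | S n = ρ}.Finite := by
    intro u
    refine (walkLaw_eval_zero G u).and ?_
    refine ae_finite_setOfPred_mem (s := fun n : ℕ => {S : ℕ → V | S n = ρ}) ?_
    refine ne_top_of_le_ne_top ?_ (ENNReal.tsum_le_tsum fun n => show _ ≤ m ^ n * W u from ?_)
    · rw [ENNReal.tsum_mul_right, ENNReal.tsum_geometric]
      exact ENNReal.mul_ne_top (ENNReal.inv_ne_top.2 (tsub_pos_of_lt hm).ne') (hWt u)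
    · refine le_trans ?_ (hWn n u)
      refine le_trans (le_of_eq ?_) (ENNReal.le_tsum ρ)
      rw [hρ, mul_one]
      rfl
  have hwalks : ∀ᵐ ω ∂(frogLaw G ρ ν₀ (plusOne π)),
      ∀ p : V × ℕ, ω.2 p 0 = p.1 ∧ {n | ω.2 p n = ρ}.Finite := by
    have h1 : ∀ᵐ ω ∂(walksLaw G), ∀ p : V × ℕ, ω p 0 = p.1 ∧ {n | ω p n = ρ}.Finite := by
      rw [ae_all_iff]
      intro p
      have h := hwalk p.1
      rw [← walksLaw_eval G p.1 p.2] at h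
      exact ae_of_ae_map (measurable_pi_apply p).aemeasurable h
    exact Measure.quasiMeasurePreserving_snd.ae h1
  filter_upwards [hret, hwalks] with ω h1 h2
  exact isTransient_of_finite (fun u i => (h2 (u, i)).1) (fun u i => (h2 (u, i)).2) h1

end Transience

/-! ### Choice of the parameters -/

lemma tsum_ofReal_pow_succ {x : ℝ} (h0 : 0 ≤ x) (h1 : x < 1) :
    ∑' n : ℕ, ENNReal.ofReal x ^ (n + 1) = ENNReal.ofReal (x / (1 - x)) := by
  simp only [pow_succ, ENNReal.tsum_mul_right, ENNReal.tsum_geometric]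
  rw [mul_comm, div_eq_mul_inv, ENNReal.ofReal_mul h0,
    ENNReal.ofReal_inv_of_pos (by linarith), ENNReal.ofReal_sub _ h0, ENNReal.ofReal_one]

/-- On the `(d + 1)`-regular tree with `14 ≤ d`, the frog model with one guaranteed frog per site is
transient when the additional counts have a small enough fractional moment. -/
lemma exists_moment_bound_transient (d : ℕ) (hd : 14 ≤ d) :
    ∃ a : ℝ, 0 < a ∧ a < 1 ∧ ∃ ε : ℝ, 0 < ε ∧
      ∀ {V : Type*} [MeasurableSpace V] [DiscreteMeasurableSpace V] (G : SimpleGraph V)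
        [G.LocallyFinite], G.IsTree → G.IsRegularOfDegree (d + 1) → ∀ (ρ : V) (π : Measure ℕ),
        IsProbabilityMeasure π → ∫⁻ k : ℕ, (k : ℝ≥0∞) ^ a ∂π ≤ ENNReal.ofReal ε →
        ∀ ν₀ : Measure ℕ, IsProbabilityMeasure ν₀ →
          AlmostSurelyTransient G ρ ν₀ (plusOne π) := by
  have hd' : (14 : ℝ) ≤ d := by exact_mod_cast hd
  set s := √(d : ℝ) with hs
  have hss : s * s = d := Real.mul_self_sqrt (by linarith)
  -- The bound m < 1/2 reads s² - 4s + 1 > 0, that is s > 2 + √3 ≈ 3.732 for the larger root; √14 ≈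
  -- 3.7417 just exceeds it.
  have hs1 : (3.74 : ℝ) ≤ s := Real.le_sqrt_of_sq_le (by norm_num; linarith)
  set m := 2 * s / (d + 1) with hm
  have hm0 : 0 ≤ m := by positivity
  have hm1 : m < 1 / 2 := by
    rw [hm, div_lt_iff₀ (by positivity)]
    nlinarith
  set q := m / (1 - m) with hq
  have hq0 : 0 ≤ q := div_nonneg hm0 (by linarith)
  have hq1 : q < 1 := by
    rw [hq, div_lt_one (by linarith)]; linarith
  have hlog : 0 < Real.log (3 / 2) := Real.log_pos (by norm_num)
  have hlogd : Real.log (3 / 2) < Real.log (d + 1) := Real.log_lt_log (by norm_num) (by linarith)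
  -- With a = 1 - b the factor λ = (d+1)^b equals 3/2, so λm < 3/4 and its geometric series is below
  -- 4.
  set b := Real.log (3 / 2) / Real.log (d + 1) with hb
  have hb0 : 0 < b := div_pos hlog (hlog.trans hlogd)
  have hb1 : b < 1 := (div_lt_one (hlog.trans hlogd)).2 hlogd
  have hpow : ((d : ℝ≥0∞) + 1) ^ b = ENNReal.ofReal (3 / 2) := by
    have h1 : ((d : ℝ≥0∞) + 1) = ENNReal.ofReal ((d : ℝ) + 1) := by
      rw [ENNReal.ofReal_add (by positivity) zero_le_one]; simp
    rw [h1, ENNReal.ofReal_rpow_of_pos (by positivity), Real.rpow_def_of_pos (by positivity), hb,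
      mul_div_cancel₀ _ (hlog.trans hlogd).ne', Real.exp_log (by norm_num)]
  -- The extra frogs then contribute at most 4ε = (1-q)/2, half the room left by q, which gives θ =
  -- (1+q)/2.
  refine ⟨1 - b, by linarith, by linarith, (1 - q) / 8, by linarith, ?_⟩
  intro V _ _ G _ hG hreg ρ π hπ hmom ν₀ hν₀
  have : Countable V := countable_of_connected_of_locallyFinite G hG.connected
  have hlm : (3 / 2 * m) / (1 - 3 / 2 * m) ≤ 4 := by
    rw [div_le_iff₀ (by linarith)]; linarith
  refine almostSurelyTransient_of_contraction G hreg
    (W := fun v => ENNReal.ofReal ((√d)⁻¹ ^ G.dist ρ v)) (by simp) (fun v => ENNReal.ofReal_ne_top)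
    (m := ENNReal.ofReal m) (θ := ENNReal.ofReal ((1 + q) / 2)) (a := 1 - b) (by linarith)
    (by linarith) rfl ?_ (tsum_stepPMF_pow_dist_le G hG (by omega) hreg ρ) π ?_ ?_ ν₀
  · rw [ENNReal.ofReal_lt_one]; linarith
  · rw [ENNReal.ofReal_lt_one]; linarith
  · rw [sub_sub_cancel, hpow, ← ENNReal.ofReal_mul (by norm_num),
      tsum_ofReal_pow_succ hm0 (by linarith), tsum_ofReal_pow_succ (by positivity) (by linarith)]
    calc ENNReal.ofReal q + (∫⁻ k : ℕ, (k : ℝ≥0∞) ^ (1 - b) ∂π) *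
          ENNReal.ofReal ((3 / 2 * m) / (1 - 3 / 2 * m))
        ≤ ENNReal.ofReal q + ENNReal.ofReal ((1 - q) / 8) * ENNReal.ofReal 4 := by gcongr
      _ = ENNReal.ofReal ((1 + q) / 2) := by
          rw [← ENNReal.ofReal_mul (by linarith), ← ENNReal.ofReal_add hq0 (by linarith)]
          congr 1; ring

/-! ### Count laws with small fractional moments -/

lemma isProbabilityMeasure_islandLaw {μ : ℝ} {N : ℕ} (hμ : 0 < μ) (hN : μ ≤ N) :
    IsProbabilityMeasure (islandLaw μ N) := by
  have hN0 : (0 : ℝ) < N := hμ.trans_le hN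
  constructor
  simp only [islandLaw, Measure.coe_add, Measure.coe_smul, Pi.add_apply, Pi.smul_apply,
    measure_univ, smul_eq_mul, mul_one]
  rw [← ENNReal.ofReal_add (by positivity) (by rw [sub_nonneg, div_le_one hN0]; exact hN)]
  simp

lemma lintegral_rpow_islandLaw {μ : ℝ} {N : ℕ} (hμ : 0 < μ) (hN : μ ≤ N) {a : ℝ} (ha : 0 < a) :
    ∫⁻ k : ℕ, (k : ℝ≥0∞) ^ a ∂(islandLaw μ N) = ENNReal.ofReal (μ * (N : ℝ) ^ (-(1 - a))) := by
  have hN0 : (0 : ℝ) < N := hμ.trans_le hN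
  rw [islandLaw, lintegral_add_measure, lintegral_smul_measure, lintegral_smul_measure,
    lintegral_dirac, lintegral_dirac]
  simp only [Nat.cast_zero, ENNReal.zero_rpow_of_pos ha, smul_eq_mul, mul_zero, add_zero]
  rw [← ENNReal.ofReal_natCast N, ENNReal.ofReal_rpow_of_pos hN0,
    ← ENNReal.ofReal_mul (by positivity), neg_sub, Real.rpow_sub_one hN0.ne']
  congr 1
  ring

/-- The heavy-tailed law putting mass `2⁻ᵏ⁻¹` on `2ᵏ⁺¹`. -/
noncomputable def dyadicLaw : Measure ℕ :=
  Measure.sum fun k : ℕ => (2⁻¹ : ℝ≥0∞) ^ (k + 1) • Measure.dirac (2 ^ (k + 1))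

lemma lintegral_dyadicLaw (f : ℕ → ℝ≥0∞) :
    ∫⁻ n, f n ∂dyadicLaw = ∑' k : ℕ, (2⁻¹ : ℝ≥0∞) ^ (k + 1) * f (2 ^ (k + 1)) := by
  simp [dyadicLaw, lintegral_sum_measure]

instance : IsProbabilityMeasure dyadicLaw := by
  constructor
  rw [← lintegral_one, lintegral_dyadicLaw]
  simp only [mul_one]
  rw [ENNReal.tsum_geometric_add_one, ENNReal.one_sub_inv_two, inv_inv,
    ENNReal.inv_mul_cancel (by norm_num) (by norm_num)]

lemma lintegral_natCast_dyadicLaw : ∫⁻ n : ℕ, (n : ℝ≥0∞) ∂dyadicLaw = ⊤ := by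
  rw [lintegral_dyadicLaw]
  have h : ∀ k : ℕ, (2⁻¹ : ℝ≥0∞) ^ (k + 1) * ((2 ^ (k + 1) : ℕ) : ℝ≥0∞) = 1 := fun k => by
    rw [Nat.cast_pow, ← mul_pow, Nat.cast_ofNat,
      ENNReal.inv_mul_cancel (by norm_num) (by norm_num), one_pow]
  simp only [h]
  exact ENNReal.tsum_const_eq_top_of_ne_zero one_ne_zero

/-- The moment is a geometric series of ratio 2^(a-1), which is below 1 exactly because a < 1; at a
= 1 every term is 1. -/
lemma lintegral_rpow_dyadicLaw_ne_top {a : ℝ} (ha : a < 1) :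
    ∫⁻ n : ℕ, (n : ℝ≥0∞) ^ a ∂dyadicLaw ≠ ⊤ := by
  rw [lintegral_dyadicLaw]
  have h : ∀ k : ℕ, (2⁻¹ : ℝ≥0∞) ^ (k + 1) * ((2 ^ (k + 1) : ℕ) : ℝ≥0∞) ^ a =
      ((2 : ℝ≥0∞) ^ (a - 1)) ^ (k + 1) := fun k => by
    rw [Nat.cast_pow, Nat.cast_ofNat, ← ENNReal.rpow_natCast 2, ← ENNReal.rpow_mul,
      mul_comm _ a, ENNReal.rpow_mul, ENNReal.rpow_natCast, ← mul_pow, sub_eq_neg_add,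
      ENNReal.rpow_add _ _ (by norm_num) (by norm_num), ENNReal.rpow_neg_one]
  have h1 : (2 : ℝ≥0∞) ^ (a - 1) < 1 := ENNReal.rpow_lt_one_of_one_lt_of_neg (by norm_num) (by linarith)
  simp only [h]
  simp only [pow_succ, ENNReal.tsum_mul_right, ENNReal.tsum_geometric]
  exact ENNReal.mul_ne_top (ENNReal.inv_ne_top.2 (tsub_pos_of_lt h1).ne') h1.ne_top

/-- Diluting `dyadicLaw` with an atom at 0 scales every positive moment by δ: the a-th one becomes
small while the mean stays infinite. -/
lemma exists_infinite_mean_small_moment {a ε : ℝ} (ha0 : 0 < a) (ha1 : a < 1) (hε : 0 < ε) :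
    ∃ π : Measure ℕ, IsProbabilityMeasure π ∧ ∫⁻ n : ℕ, (n : ℝ≥0∞) ∂π = ⊤ ∧
      ∫⁻ n : ℕ, (n : ℝ≥0∞) ^ a ∂π ≤ ENNReal.ofReal ε := by
  set C := ∫⁻ n : ℕ, (n : ℝ≥0∞) ^ a ∂dyadicLaw with hC
  have hCt : C ≠ ⊤ := lintegral_rpow_dyadicLaw_ne_top ha1
  set δ := min 1 (ENNReal.ofReal ε / C) with hδ
  have hδ0 : δ ≠ 0 := by
    refine (lt_min zero_lt_one (ENNReal.div_pos ?_ hCt)).ne'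
    simpa using hε
  refine ⟨δ • dyadicLaw + (1 - δ) • Measure.dirac 0, ⟨?_⟩, ?_, ?_⟩
  · simp only [Measure.coe_add, Measure.coe_smul, Pi.add_apply, Pi.smul_apply, measure_univ,
      smul_eq_mul, mul_one]
    exact add_tsub_cancel_of_le (min_le_left _ _)
  · rw [lintegral_add_measure, lintegral_smul_measure, lintegral_natCast_dyadicLaw, smul_eq_mul,
      ENNReal.mul_top hδ0, top_add]
  · rw [lintegral_add_measure, lintegral_smul_measure, lintegral_smul_measure, lintegral_dirac]
    simp only [Nat.cast_zero, ENNReal.zero_rpow_of_pos ha0, smul_eq_mul, mul_zero, add_zero]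
    rw [← hC]
    rw [mul_comm]
    exact (mul_le_mul_right (min_le_right _ _) C).trans ENNReal.mul_div_le

end FrogModel

theorem mainTheorem4 {V : Type*} [MeasurableSpace V] [DiscreteMeasurableSpace V]
    (d : ℕ) (hd : 14 ≤ d)
    (G : SimpleGraph V) [G.LocallyFinite] (hG : G.IsTree) (hreg : G.IsRegularOfDegree (d + 1))
    (ρ : V) :
    (∀ μ : ℝ, 0 < μ → ∃ N₀ : ℕ, μ ≤ N₀ ∧ ∀ N : ℕ, N₀ ≤ N →
      ∀ ν₀ : Measure ℕ, IsProbabilityMeasure ν₀ →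
        FrogModel.AlmostSurelyTransient G ρ ν₀ (FrogModel.plusOne (FrogModel.islandLaw μ N))) ∧
    (∃ π : Measure ℕ, IsProbabilityMeasure π ∧ ∫⁻ n : ℕ, (n : ℝ≥0∞) ∂π = ⊤ ∧
      ∀ ν₀ : Measure ℕ, IsProbabilityMeasure ν₀ →
        FrogModel.AlmostSurelyTransient G ρ ν₀ (FrogModel.plusOne π)) := by

  obtain ⟨a, ha0, ha1, ε, hε, key⟩ := FrogModel.exists_moment_bound_transient d hd
  constructor
  · intro μ hμ
    -- The a-th moment of the island law is μ N^(a-1), which vanishes as N grows although the mean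
    -- stays μ.
    have hlim : Filter.Tendsto (fun N : ℕ => μ * (N : ℝ) ^ (-(1 - a))) Filter.atTop (nhds 0) := by
      simpa using ((tendsto_rpow_neg_atTop (sub_pos.2 ha1)).comp
        tendsto_natCast_atTop_atTop).const_mul μ
    obtain ⟨N₁, hN₁⟩ := Filter.eventually_atTop.1 (hlim.eventually_le_const hε)
    refine ⟨max N₁ ⌈μ⌉₊, (Nat.le_ceil μ).trans (by exact_mod_cast le_max_right _ _), ?_⟩
    intro N hN ν₀ hν₀
    have hμN : μ ≤ N := (Nat.le_ceil μ).trans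
      (by exact_mod_cast (le_max_right _ _).trans hN)
    refine key G hG hreg ρ _ (FrogModel.isProbabilityMeasure_islandLaw hμ hμN) ?_ ν₀ hν₀
    rw [FrogModel.lintegral_rpow_islandLaw hμ hμN ha0]
    exact ENNReal.ofReal_le_ofReal (hN₁ N ((le_max_left _ _).trans hN))
  · obtain ⟨π, hπ, hmean, hmom⟩ := FrogModel.exists_infinite_mean_small_moment ha0 ha1 hε
    exact ⟨π, hπ, hmean, key G hG hreg ρ π hπ hmom⟩
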